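/- Let $\mathbb{F}_2^n$ carry the Hamming distance $d$. For a nonempty set $X\subseteq\mathbb{F}_2^n$ put $d(y,X)=\min_{x\in X}d(y,x)$ and $\rho(X)=\max_{z\in\mathbb{F}_2^n}d(z,X)$ (the covering radius of $X$), and call $\widehat{X}=\{y\in\mathbb{F}_2^n : d(y,X)=\rho(X)\}$ the metric complement of $X$. The set $X$ is called metrically regular if $\widehat{\widehat{X}}=X$. Identify a Boolean function $f:\mathbb{F}_2^m\to\mathbb{F}_2$ with its vector of values in $\mathbb{F}_2^{2^m}$, and let the Reed–Muller code $\mathcal{RM}(k,m)$ be the set of all Boolean functions in $m$ variables whose algebraic normal form (the unique polynomial over $\mathbb{F}_2$, of degree at most one in each variable, that represents the function) has degree at most $k$. **Theorem.** The Reed–Muller code $\mathcal{RM}(1,5)$, i.e. the set of affine Boolean functions in $5$ variables, is metrically regular. -/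

import Mathlib

/-! Metric notions in the space of binary vectors with coordinates indexed by a finite type. -/

section Metric

variable {ι : Type*} [Fintype ι] [DecidableEq ι]

/-- The Hamming distance `d(y, X) = min_{x ∈ X} d(y, x)` from a vector to a (nonempty) set. -/
noncomputable def distToSet (y : ι → ZMod 2) (X : Set (ι → ZMod 2)) : ℕ :=
  sInf ((fun x => hammingDist y x) '' X)

/-- The covering radius `ρ(X) = max_z d(z, X)`. -/
noncomputable def coveringRadius (X : Set (ι → ZMod 2)) : ℕ :=
  Finset.univ.sup (fun z : ι → ZMod 2 => distToSet z X)

/-- The metric complement of `X`: all vectors at the maximal possible distance from `X`. -/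
def metricComplement (X : Set (ι → ZMod 2)) : Set (ι → ZMod 2) :=
  {y | distToSet y X = coveringRadius X}

/-- `X` is metrically regular if it is the metric complement of its metric complement. -/
def MetricallyRegular (X : Set (ι → ZMod 2)) : Prop :=
  metricComplement (metricComplement X) = X

end Metric

/-! Boolean functions, the algebraic normal form and Reed-Muller codes. -/

/-- Boolean functions in `m` variables. Such a function is also its own value vector, whose
coordinates are indexed by the `2 ^ m` points of the cube. -/
abbrev BoolFun (m : ℕ) : Type := (Fin m → ZMod 2) → ZMod 2

/-- The Boolean function given by the multilinear polynomial with coefficients `a`: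
`x ↦ ∑_S a_S ∏_{i ∈ S} x_i`. -/
def evalANF {m : ℕ} (a : Finset (Fin m) → ZMod 2) : BoolFun m :=
  fun x => ∑ S : Finset (Fin m), a S * ∏ i ∈ S, x i

theorem evalANF_indicator {m : ℕ} (a : Finset (Fin m) → ZMod 2) (S : Finset (Fin m)) :
    evalANF a (fun i => if i ∈ S then 1 else 0) = ∑ T ∈ S.powerset, a T := by
  classical
  unfold evalANF
  rw [← Finset.sum_subset (Finset.subset_univ S.powerset)]
  · refine Finset.sum_congr rfl fun T hT => ?_
    rw [Finset.prod_eq_one, mul_one]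
    intro i hi
    exact if_pos (Finset.mem_powerset.1 hT hi)
  · intro T _ hT
    rw [Finset.mem_powerset, Finset.not_subset] at hT
    obtain ⟨i, hi, hiS⟩ := hT
    rw [Finset.prod_eq_zero hi (if_neg hiS), mul_zero]

theorem evalANF_injective (m : ℕ) :
    Function.Injective (evalANF : (Finset (Fin m) → ZMod 2) → BoolFun m) := by
  classical
  intro a b h
  funext S
  induction S using Finset.strongInduction with
  | H S ih =>
    have h1 := congrFun h (fun i => if i ∈ S then 1 else 0)
    rw [evalANF_indicator, evalANF_indicator,
      ← Finset.sum_erase_add _ a (Finset.mem_powerset_self S),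
      ← Finset.sum_erase_add _ b (Finset.mem_powerset_self S),
      Finset.sum_congr rfl (g := b)] at h1
    · exact add_left_cancel h1
    · intro T hT
      rw [Finset.mem_erase, Finset.mem_powerset] at hT
      exact ih T (hT.2.ssubset_of_ne hT.1)

theorem evalANF_bijective (m : ℕ) :
    Function.Bijective (evalANF : (Finset (Fin m) → ZMod 2) → BoolFun m) := by
  classical
  rw [Fintype.bijective_iff_injective_and_card]
  refine ⟨evalANF_injective m, ?_⟩
  simp [ZMod.card]

/-- The algebraic normal form of `f`: the coefficients of the unique multilinear polynomial over
`ZMod 2` that represents `f`. -/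
noncomputable def anf {m : ℕ} (f : BoolFun m) : Finset (Fin m) → ZMod 2 :=
  (Equiv.ofBijective evalANF (evalANF_bijective m)).symm f

theorem evalANF_anf {m : ℕ} (f : BoolFun m) : evalANF (anf f) = f :=
  (Equiv.ofBijective evalANF (evalANF_bijective m)).apply_symm_apply f

theorem anf_evalANF {m : ℕ} (a : Finset (Fin m) → ZMod 2) : anf (evalANF a) = a :=
  evalANF_injective m (evalANF_anf (evalANF a))

/-- The degree of the algebraic normal form of `f` (with value `0` for the zero function). -/
noncomputable def algDegree {m : ℕ} (f : BoolFun m) : ℕ :=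
  (Finset.univ.filter (fun S : Finset (Fin m) => anf f S ≠ 0)).sup Finset.card

/-- The Reed-Muller code of order `k` in `m` variables. -/
def reedMuller (k m : ℕ) : Set (BoolFun m) :=
  {f | algDegree f ≤ k}

/-! Affine Boolean functions. -/

section Affine

variable {m : ℕ}

/-! Both covering radii equal 12. Let Q be the set of functions at distance at least 12 from every
affine function. It contains x₀x₁ + x₂x₃, so once the covering radius is known to be at most 12, the
metric complement of the code is Q. As Q is invariant under adding affine functions, its own
covering radius is also 12, and its metric complement is the set of f with f + Q ⊆ Q.

This stabilizer is closed under addition and under affine involutions of the variables, hence under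
f ↦ D_i f and f ↦ x_k D_i f for k ≠ i. From one non-affine member these operations produce every
product of two distinct variables, hence x₀x₁ + x₂x₃. Translating that element of Q by itself would
put 0 in Q, which is absurd; so the stabilizer consists of affine functions.

The bound 12 is a Walsh transform argument (`exists_hammingDist_le_twelve`): even weight contradicts
Parseval directly, odd weight contradicts it for the indicator of the points where the transform is
±2. -/

/-- The affine Boolean function `x ↦ c + ∑ i, u i * x i`. -/
def affineFun (c : ZMod 2) (u : Fin m → ZMod 2) : BoolFun m :=
  fun x => c + ∑ i, u i * x i

theorem affineFun_add (c d : ZMod 2) (u v : Fin m → ZMod 2) :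
    affineFun c u + affineFun d v = affineFun (c + d) (u + v) := by
  funext x
  simp only [affineFun, Pi.add_apply, add_mul, Finset.sum_add_distrib]
  ring

theorem mem_reedMuller_iff {k : ℕ} {f : BoolFun m} :
    f ∈ reedMuller k m ↔ ∀ T, anf f T ≠ 0 → T.card ≤ k := by
  simp [reedMuller, algDegree, Finset.sup_le_iff]

theorem evalANF_eq_affineFun (a : Finset (Fin m) → ZMod 2) (ha : ∀ T, a T ≠ 0 → T.card ≤ 1) :
    ∃ c u, evalANF a = affineFun c u := by
  have key : ∃ c u, (∑ T : Finset (Fin m), fun x : Fin m → ZMod 2 => a T * ∏ i ∈ T, x i)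
      = affineFun c u := by
    refine Finset.sum_induction _ (fun f : BoolFun m => ∃ c u, f = affineFun c u) ?_ ?_ ?_
    · rintro _ _ ⟨c, u, rfl⟩ ⟨d, v, rfl⟩
      exact ⟨_, _, affineFun_add c d u v⟩
    · exact ⟨0, 0, by funext x; simp [affineFun]⟩
    · intro T _
      by_cases h : a T = 0
      · exact ⟨0, 0, by funext x; simp [affineFun, h]⟩
      · rcases Nat.le_one_iff_eq_zero_or_eq_one.1 (ha T h) with h0 | h1
        · rw [Finset.card_eq_zero] at h0
          exact ⟨a T, 0, by funext x; simp [affineFun, h0]⟩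
        · obtain ⟨i, rfl⟩ := Finset.card_eq_one.1 h1
          refine ⟨0, Pi.single i (a {i}), ?_⟩
          funext x
          simp [affineFun, Pi.single_apply]
  obtain ⟨c, u, h⟩ := key
  refine ⟨c, u, ?_⟩
  rw [← h]
  funext x
  simp [evalANF, Finset.sum_apply]

theorem affineFun_eq_evalANF (c : ZMod 2) (u : Fin m → ZMod 2) :
    affineFun c u =
      evalANF (fun T => (if T = ∅ then c else 0) + ∑ i, if T = {i} then u i else 0) := by
  funext x
  simp only [affineFun, evalANF, add_mul, Finset.sum_add_distrib, Finset.sum_mul]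
  rw [Finset.sum_comm]
  simp

theorem mem_reedMuller_one_iff {f : BoolFun m} :
    f ∈ reedMuller 1 m ↔ ∃ c u, f = affineFun c u := by
  rw [mem_reedMuller_iff]
  constructor
  · intro h
    rw [← evalANF_anf f]
    exact evalANF_eq_affineFun _ h
  · rintro ⟨c, u, rfl⟩ T hT
    rw [affineFun_eq_evalANF, anf_evalANF] at hT
    by_contra! hc
    refine hT ?_
    rw [if_neg (by rintro rfl; simp at hc), zero_add]
    refine Finset.sum_eq_zero fun i _ => if_neg ?_
    rintro rfl
    simp at hc

theorem add_mem_reedMuller_one {f g : BoolFun m} (hf : f ∈ reedMuller 1 m)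
    (hg : g ∈ reedMuller 1 m) : f + g ∈ reedMuller 1 m := by
  rw [mem_reedMuller_one_iff] at *
  obtain ⟨c, u, rfl⟩ := hf
  obtain ⟨d, v, rfl⟩ := hg
  exact ⟨_, _, affineFun_add c d u v⟩

/-- Precomposition with the map `x ↦ x + L x • eᵢ`, where `L` is affine, preserves affine
functions. -/
theorem comp_add_single_mem_reedMuller_one {f L : BoolFun m} (hf : f ∈ reedMuller 1 m)
    (hL : L ∈ reedMuller 1 m) (i : Fin m) :
    (fun x => f (x + Pi.single i (L x))) ∈ reedMuller 1 m := by
  rw [mem_reedMuller_one_iff] at *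
  obtain ⟨c, u, rfl⟩ := hf
  obtain ⟨d, v, rfl⟩ := hL
  refine ⟨c + u i * d, u + u i • v, ?_⟩
  funext x
  simp only [affineFun, Pi.add_apply, mul_add, add_mul, Finset.sum_add_distrib, Pi.smul_apply,
    smul_eq_mul, mul_assoc]
  simp only [Pi.single_apply, mul_ite, mul_zero, Finset.sum_ite_eq', Finset.mem_univ, if_true,
    mul_add, Finset.mul_sum]
  ring

end Affine

/-! Derivatives of Boolean functions along coordinates. -/

section Derivative

variable {m : ℕ}

/-- The derivative of `f` in the direction of the `i`-th coordinate. -/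
def coordDeriv (i : Fin m) (f : BoolFun m) : BoolFun m :=
  fun x => f x + f (x + Pi.single i 1)

/-- The `i`-th coordinate as a Boolean function. -/
def coordFun (i : Fin m) : BoolFun m := fun x => x i

theorem coordFun_mem_reedMuller_one (i : Fin m) : coordFun i ∈ reedMuller 1 m :=
  mem_reedMuller_one_iff.2 ⟨0, Pi.single i 1, by funext x; simp [coordFun, affineFun,
    Pi.single_apply]⟩

theorem const_mem_reedMuller_one (c : ZMod 2) : (fun _ => c) ∈ reedMuller 1 m :=
  mem_reedMuller_one_iff.2 ⟨c, 0, by funext x; simp [affineFun]⟩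

theorem zmod_two_eq_zero_or_one (c : ZMod 2) : c = 0 ∨ c = 1 := by
  revert c; decide

/-- This writes x_k D_i f as the sum of f and its composite with a transvection, so that invariance
under addition and affine substitutions yields closure under x_k D_i. -/
theorem coordFun_mul_coordDeriv (k i : Fin m) (f : BoolFun m) :
    coordFun k * coordDeriv i f = f + fun x => f (x + Pi.single i (coordFun k x)) := by
  funext x
  simp only [coordFun, coordDeriv, Pi.mul_apply, Pi.add_apply]
  rcases zmod_two_eq_zero_or_one (x k) with h | h
  · simp [h, CharTwo.add_self_eq_zero]
  · simp [h]

theorem coordDeriv_coordFun_mul {k i : Fin m} (h : k ≠ i) (f : BoolFun m) :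
    coordDeriv i (coordFun k * f) = coordFun k * coordDeriv i f := by
  funext x
  simp [coordFun, coordDeriv, h, mul_add]

theorem coordDeriv_coordFun (i : Fin m) : coordDeriv i (coordFun i) = 1 := by
  funext x
  simp [coordFun, coordDeriv, ← add_assoc, CharTwo.add_self_eq_zero]

/-- Monomials without x_i cancel, and each monomial containing x_i loses that factor. -/
theorem coordDeriv_evalANF (i : Fin m) (a : Finset (Fin m) → ZMod 2) :
    coordDeriv i (evalANF a) = evalANF (fun T => if i ∈ T then 0 else a (insert i T)) := by
  funext x
  simp only [coordDeriv, evalANF, ← Finset.sum_add_distrib, ← mul_add]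
  rw [← Finset.sum_filter_add_sum_filter_not _ (fun T : Finset (Fin m) => i ∈ T),
    ← Finset.sum_filter_add_sum_filter_not (f := fun T => (if i ∈ T then 0 else _) * _)
      Finset.univ (fun T : Finset (Fin m) => i ∈ T)]
  have h1 : ∀ T : Finset (Fin m), i ∉ T →
      ∏ j ∈ T, (x + Pi.single i 1 : Fin m → ZMod 2) j = ∏ j ∈ T, x j := by
    intro T hT
    refine Finset.prod_congr rfl fun j hj => ?_
    have : j ≠ i := by rintro rfl; exact hT hj
    simp [this]
  rw [add_comm]
  refine congrArg₂ _ ?_ ?_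
  · rw [Finset.sum_eq_zero, Finset.sum_eq_zero]
    · intro T hT
      simp [(Finset.mem_filter.1 hT).2]
    · intro T hT
      rw [h1 T (Finset.mem_filter.1 hT).2, CharTwo.add_self_eq_zero, mul_zero]
  · refine Finset.sum_bij' (fun T _ => T.erase i) (fun T _ => insert i T) ?_ ?_ ?_ ?_ ?_
    · simp
    · simp
    · intro T hT
      exact Finset.insert_erase (Finset.mem_filter.1 hT).2
    · intro T hT
      exact Finset.erase_insert (Finset.mem_filter.1 hT).2
    · intro T hT
      have hi := (Finset.mem_filter.1 hT).2
      have hn : i ∉ T.erase i := Finset.notMem_erase i T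
      rw [if_neg hn, Finset.insert_erase hi, ← Finset.mul_prod_erase T x hi,
        ← Finset.mul_prod_erase T (x + Pi.single i 1 : Fin m → ZMod 2) hi, h1 _ hn, ← add_mul]
      simp [← add_assoc, CharTwo.add_self_eq_zero]

/-- A set of Boolean functions closed under `D i` and `x k * D i` for `k ≠ i`. -/
structure ClosedUnderDeriv (V : Set (BoolFun m)) : Prop where
  deriv_mem : ∀ i, ∀ f ∈ V, coordDeriv i f ∈ V
  mul_deriv_mem : ∀ k i, k ≠ i → ∀ f ∈ V, coordFun k * coordDeriv i f ∈ V

theorem ClosedUnderDeriv.coordFun_mul_mem {V : Set (BoolFun m)} (hV : ClosedUnderDeriv V)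
    {l n : Fin m} (hln : l ≠ n) (h : coordFun l * coordFun n ∈ V) {p q : Fin m} (hpq : p ≠ q) :
    coordFun p * coordFun q ∈ V := by
  -- One factor can be exchanged: x_p D_l (x_l x_n) = x_p x_n.
  have step : ∀ {l n p : Fin m}, l ≠ n → p ≠ n → coordFun l * coordFun n ∈ V →
      coordFun p * coordFun n ∈ V := by
    intro l n p hln hpn h
    by_cases hpl : p = l
    · rwa [hpl]
    · have := hV.mul_deriv_mem p l hpl _ h
      rwa [mul_comm (coordFun l), coordDeriv_coordFun_mul hln.symm, coordDeriv_coordFun,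
        mul_one] at this
  by_cases hpn : p = n
  · subst hpn
    rw [mul_comm] at h ⊢
    rw [mul_comm] at h
    exact step hln hpq.symm h
  · have h2 := step hln hpn h
    rw [mul_comm] at h2 ⊢
    exact step (Ne.symm hpn) hpq.symm h2

/-- Differentiating along a variable of a top-degree monomial lowers the degree by one, which
reduces to degree 2. There the linear and constant terms still have to be removed. -/
theorem ClosedUnderDeriv.exists_coordFun_mul_mem {V : Set (BoolFun m)} (hV : ClosedUnderDeriv V)
    (hm : 3 ≤ m) (n : ℕ) : ∀ (a : Finset (Fin m) → ZMod 2) (T : Finset (Fin m)),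
    evalANF a ∈ V → T.card = n + 2 → a T ≠ 0 → (∀ U, a U ≠ 0 → U.card ≤ n + 2) →
    ∃ l k : Fin m, l ≠ k ∧ coordFun l * coordFun k ∈ V := by
  induction n with
  | zero =>
    intro a T ha hT haT hmax
    obtain ⟨j, k, hjk, rfl⟩ := Finset.card_eq_two.1 hT
    -- With a third variable x_n, available as m ≥ 3, x_j D_k (x_n D_j f) = x_j x_n D_k D_j f; the
    -- second derivative is the constant 1 because x_j x_k is a top-degree term.
    obtain ⟨n, hn⟩ : ∃ n, n ∉ ({j, k} : Finset (Fin m)) := by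
      by_contra! hc
      have := Finset.card_le_card (fun x _ => hc x : Finset.univ ⊆ ({j, k} : Finset (Fin m)))
      rw [hT, Finset.card_univ, Fintype.card_fin] at this
      omega
    rw [Finset.mem_insert, Finset.mem_singleton, not_or] at hn
    refine ⟨j, n, Ne.symm hn.1, ?_⟩
    have h := hV.mul_deriv_mem j k hjk _ (hV.mul_deriv_mem n j hn.1 _ ha)
    rw [coordDeriv_coordFun_mul hn.2] at h
    have h1 : coordDeriv k (coordDeriv j (evalANF a)) = 1 := by
      rw [coordDeriv_evalANF, coordDeriv_evalANF]
      funext x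
      rw [evalANF, Finset.sum_eq_single ∅]
      · have : a {j, k} = 1 := (zmod_two_eq_zero_or_one _).resolve_left haT
        simp [hjk, this]
      · intro U _ hU
        have : U.Nonempty := Finset.nonempty_iff_ne_empty.2 hU
        by_cases hkU : k ∈ U
        · simp [hkU]
        · by_cases hjU : j ∈ insert k U
          · simp [hjU]
          · have h3 : a (insert j (insert k U)) = 0 := by
              by_contra h0
              have := hmax _ h0
              rw [Finset.card_insert_of_notMem hjU, Finset.card_insert_of_notMem hkU] at this
              have := Finset.card_pos.2 ‹U.Nonempty›
              omega
            rw [if_neg hkU, if_neg hjU, h3, zero_mul]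
      · simp
    rwa [h1, mul_one] at h
  | succ n ih =>
    intro a T ha hT haT hmax
    obtain ⟨i, hi⟩ : T.Nonempty := Finset.card_pos.1 (by omega)
    refine ih _ (T.erase i) ((coordDeriv_evalANF i a) ▸ hV.deriv_mem i _ ha) ?_ ?_ ?_
    · rw [Finset.card_erase_of_mem hi]; omega
    · rw [if_neg (Finset.notMem_erase i T), Finset.insert_erase hi]
      exact haT
    · intro U hU
      by_cases hiU : i ∈ U
      · simp [hiU] at hU
      · rw [if_neg hiU] at hU
        have := hmax _ hU
        rw [Finset.card_insert_of_notMem hiU] at this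
        omega

theorem ClosedUnderDeriv.coordFun_mul_coordFun_mem {V : Set (BoolFun m)}
    (hV : ClosedUnderDeriv V) (hm : 3 ≤ m) {f : BoolFun m} (hf : f ∈ V)
    (hf1 : f ∉ reedMuller 1 m) {p q : Fin m} (hpq : p ≠ q) : coordFun p * coordFun q ∈ V := by
  rw [mem_reedMuller_iff] at hf1
  push Not at hf1
  obtain ⟨T₀, hT₀, hc⟩ := hf1
  obtain ⟨T, hT, hmax⟩ := Finset.exists_max_image
    (Finset.univ.filter fun S : Finset (Fin m) => anf f S ≠ 0) Finset.card ⟨T₀, by simpa using hT₀⟩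
  simp only [Finset.mem_filter, Finset.mem_univ, true_and] at hT hmax
  have h2 := hmax T₀ hT₀
  -- The truncated subtraction is exact: a monomial of maximal degree in a non-affine function has
  -- degree at least 2.
  obtain ⟨l, n, hln, h⟩ := hV.exists_coordFun_mul_mem hm (T.card - 2) (anf f) T
    (by rwa [evalANF_anf]) (by omega) hT (fun U hU => by have := hmax U hU; omega)
  exact hV.coordFun_mul_mem hln h hpq

end Derivative

/-! Functions far from all affine functions. -/

section Far

variable {m : ℕ}

theorem hammingDist_add_left_eq (f g h : BoolFun m) :
    hammingDist (f + g) h = hammingDist f (g + h) := by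
  unfold hammingDist
  congr 1
  refine Finset.filter_congr fun x _ => not_congr ?_
  simp only [Pi.add_apply]
  generalize f x = a
  generalize g x = b
  generalize h x = c
  revert a b c
  decide

theorem hammingDist_comp_involutive {e : (Fin m → ZMod 2) → (Fin m → ZMod 2)}
    (he : Function.Involutive e) (f g : BoolFun m) :
    hammingDist (f ∘ e) g = hammingDist f (g ∘ e) := by
  unfold hammingDist
  refine Finset.card_bij' (fun x _ => e x) (fun x _ => e x) ?_ ?_ ?_ ?_ <;> simp [he _]

/-- The functions at distance at least `t` from all affine functions. -/
def farFromAffine (m t : ℕ) : Set (BoolFun m) :=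
  {f | ∀ g ∈ reedMuller 1 m, t ≤ hammingDist f g}

/-- The translations that map `farFromAffine m t` into itself. -/
def farStabilizer (m t : ℕ) : Set (BoolFun m) :=
  {f | ∀ g ∈ farFromAffine m t, f + g ∈ farFromAffine m t}

theorem add_mem_farFromAffine {t : ℕ} {f g : BoolFun m} (hf : f ∈ farFromAffine m t)
    (hg : g ∈ reedMuller 1 m) : f + g ∈ farFromAffine m t := by
  intro h hh
  rw [hammingDist_add_left_eq]
  exact hf _ (add_mem_reedMuller_one hg hh)

theorem add_mem_farStabilizer {t : ℕ} {f g : BoolFun m} (hf : f ∈ farStabilizer m t)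
    (hg : g ∈ farStabilizer m t) : f + g ∈ farStabilizer m t := by
  intro h hh
  rw [add_assoc]
  exact hf _ (hg _ hh)

/-- The substitution e preserves the far functions because it preserves the affine ones; then f ∘ e
+ g = (f + g ∘ e) ∘ e. -/
theorem comp_mem_farStabilizer {t : ℕ} {e : (Fin m → ZMod 2) → (Fin m → ZMod 2)}
    (he : Function.Involutive e) (hR : ∀ f ∈ reedMuller 1 m, f ∘ e ∈ reedMuller 1 m)
    {f : BoolFun m} (hf : f ∈ farStabilizer m t) : f ∘ e ∈ farStabilizer m t := by
  have hQ : ∀ g ∈ farFromAffine m t, g ∘ e ∈ farFromAffine m t := by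
    intro g hg h hh
    rw [hammingDist_comp_involutive he]
    exact hg _ (hR _ hh)
  intro g hg
  have h := hQ _ (hf _ (hQ g hg))
  have h2 : (f + g ∘ e) ∘ e = f ∘ e + g := by
    funext x
    simp [he x]
  rwa [h2] at h

theorem comp_add_single_mem_farStabilizer {t : ℕ} {f L : BoolFun m}
    (hf : f ∈ farStabilizer m t) (hL : L ∈ reedMuller 1 m) (i : Fin m)
    (hLi : ∀ x c, L (x + Pi.single i c) = L x) :
    (fun x => f (x + Pi.single i (L x))) ∈ farStabilizer m t := by
  have hR : ∀ g ∈ reedMuller 1 m, g ∘ (fun x => x + Pi.single i (L x)) ∈ reedMuller 1 m := by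
    intro g hg
    have h := comp_add_single_mem_reedMuller_one hg hL i
    rwa [Function.comp_def]
  have h := comp_mem_farStabilizer (t := t) (fun x => ?_) hR hf
  · rwa [Function.comp_def] at h
  simp only [hLi, add_assoc]
  rw [← Pi.single_add, CharTwo.add_self_eq_zero, Pi.single_zero, add_zero]

theorem closedUnderDeriv_farStabilizer (m t : ℕ) : ClosedUnderDeriv (farStabilizer m t) where
  deriv_mem i f hf := by
    have h := comp_add_single_mem_farStabilizer hf (const_mem_reedMuller_one 1) i fun _ _ => rfl
    exact add_mem_farStabilizer hf h
  mul_deriv_mem k i hki f hf := by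
    rw [coordFun_mul_coordDeriv]
    refine add_mem_farStabilizer hf
      (comp_add_single_mem_farStabilizer hf (coordFun_mem_reedMuller_one k) i fun x c => ?_)
    simp [coordFun, hki]

end Far

/-! Walsh coefficients. -/

section Walsh

variable {m : ℕ}

/-- The sign `(-1) ^ c`. -/
def signZMod (c : ZMod 2) : ℤ := if c = 0 then 1 else -1

theorem signZMod_add (c d : ZMod 2) : signZMod (c + d) = signZMod c * signZMod d := by
  revert c d; decide

/-- The Walsh-Hadamard transform. -/
def walsh (g : (Fin m → ZMod 2) → ℤ) (u : Fin m → ZMod 2) : ℤ :=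
  ∑ x, g x * signZMod (u ⬝ᵥ x)

theorem sum_signZMod_dotProduct (z : Fin m → ZMod 2) :
    ∑ u : Fin m → ZMod 2, signZMod (u ⬝ᵥ z) = if z = 0 then 2 ^ m else 0 := by
  split_ifs with hz
  · subst hz
    simp [signZMod, ZMod.card]
  · obtain ⟨i, hi⟩ := Function.ne_iff.1 hz
    have hi1 : z i = 1 := (zmod_two_eq_zero_or_one _).resolve_left hi
    -- Flipping the i-th bit of u, where z i = 1, negates every term, so the sum equals its own
    -- negative.
    have h := Equiv.sum_comp (Equiv.addRight (Pi.single i (1 : ZMod 2)))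
      (fun u : Fin m → ZMod 2 => signZMod (u ⬝ᵥ z))
    simp only [Equiv.coe_addRight, add_dotProduct, single_dotProduct, hi1, mul_one,
      signZMod_add] at h
    rw [← Finset.sum_mul, show signZMod 1 = -1 from rfl] at h
    linarith

/-- Expand both transforms; summing over u, orthogonality of characters keeps only y = x + a. The
case a = 0, g = h is Parseval's identity. -/
theorem sum_walsh_mul_walsh (g h : (Fin m → ZMod 2) → ℤ) (a : Fin m → ZMod 2) :
    ∑ u, walsh g u * walsh h u * signZMod (u ⬝ᵥ a) = 2 ^ m * ∑ x, g x * h (x + a) := by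
  have h1 : ∀ u, walsh g u * walsh h u * signZMod (u ⬝ᵥ a)
      = ∑ x, ∑ y, g x * h y * signZMod (u ⬝ᵥ (x + y + a)) := by
    intro u
    rw [walsh, walsh, Finset.sum_mul_sum]
    simp only [Finset.sum_mul, dotProduct_add, signZMod_add]
    refine Finset.sum_congr rfl fun x _ => Finset.sum_congr rfl fun y _ => ?_
    ring
  have h2 : ∀ x y : Fin m → ZMod 2, x + y + a = 0 ↔ y = x + a := by
    intro x y
    simp only [funext_iff, Pi.add_apply, Pi.zero_apply]
    refine forall_congr' fun i => ?_
    generalize x i = b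
    generalize y i = c
    generalize a i = d
    revert b c d
    decide
  simp only [h1]
  rw [Finset.sum_comm, Finset.mul_sum]
  refine Finset.sum_congr rfl fun x _ => ?_
  rw [Finset.sum_comm]
  simp only [← Finset.mul_sum, sum_signZMod_dotProduct, h2]
  simp
  ring

theorem sum_walsh_sq (g : (Fin m → ZMod 2) → ℤ) :
    ∑ u, walsh g u ^ 2 = 2 ^ m * ∑ x, g x ^ 2 := by
  have h := sum_walsh_mul_walsh g g 0
  simpa [signZMod, ← sq] using h

theorem sum_signZMod_add (f g : BoolFun m) :
    ∑ x, signZMod (f x + g x) = 2 ^ m - 2 * hammingDist f g := by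
  have h : ∀ x, signZMod (f x + g x) = 1 - 2 * (if f x ≠ g x then 1 else 0) := by
    intro x
    generalize f x = b
    generalize g x = c
    revert b c
    decide
  simp only [h, Finset.sum_sub_distrib, ← Finset.mul_sum, Finset.sum_boole]
  simp [hammingDist, ZMod.card]

theorem walsh_signZMod (f : BoolFun m) (u : Fin m → ZMod 2) :
    walsh (fun x => signZMod (f x)) u = 2 ^ m - 2 * hammingDist f (affineFun 0 u) := by
  rw [← sum_signZMod_add]
  simp [walsh, signZMod_add, affineFun, dotProduct]

theorem hammingDist_affineFun_one (f : BoolFun m) (u : Fin m → ZMod 2) :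
    hammingDist f (affineFun 0 u) + hammingDist f (affineFun 1 u) = 2 ^ m := by
  have h0 := sum_signZMod_add f (affineFun 0 u)
  have h1 := sum_signZMod_add f (affineFun 1 u)
  have h2 : ∑ x, signZMod (f x + affineFun 1 u x) = - ∑ x, signZMod (f x + affineFun 0 u x) := by
    rw [← Finset.sum_neg_distrib]
    refine Finset.sum_congr rfl fun x _ => ?_
    simp only [affineFun, signZMod_add]
    rw [show signZMod 1 = -1 from rfl, show signZMod 0 = 1 from rfl]
    ring
  rw [h0, h1] at h2
  zify
  linarith

theorem cast_hammingDist (f g : BoolFun m) :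
    (hammingDist f g : ZMod 2) = ∑ x, f x + ∑ x, g x := by
  rw [hammingDist, ← Finset.sum_boole, ← Finset.sum_add_distrib]
  refine Finset.sum_congr rfl fun x _ => ?_
  generalize f x = b
  generalize g x = c
  revert b c
  decide

/-- The points x and x + a are distinct and contribute equal terms, which cancel modulo 2. -/
theorem sum_mul_translate (f : BoolFun m) {a : Fin m → ZMod 2} (ha : a ≠ 0) :
    ∑ x, f x * f (x + a) = 0 := by
  have haa : ∀ x : Fin m → ZMod 2, x + a + a = x := fun x => by
    funext i
    simp [add_assoc, CharTwo.add_self_eq_zero]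
  refine Finset.sum_involution (fun x _ => x + a) ?_ ?_ ?_ ?_
  · intro x _
    rw [haa, mul_comm, CharTwo.add_self_eq_zero]
  · intro x _ _ h
    exact ha (by simpa using h)
  · simp
  · intro x _
    exact haa x

/-- With w the weight of f and s the overlap of the supports of f and its translate, the sum is 2^m
- 4w + 4s. Here 8 divides 2^m, w is odd and s is even. -/
theorem autocorrelation_mod_eight (hm : 3 ≤ m) {f : BoolFun m} (hf : ∑ x, f x = 1)
    {a : Fin m → ZMod 2} (ha : a ≠ 0) :
    ∃ k : ℤ, ∑ x, signZMod (f x) * signZMod (f (x + a)) = 8 * k + 4 := by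
  have hs : ∀ c : ZMod 2, signZMod c = 1 - 2 * (c.val : ℤ) := by decide
  have ht : ∑ x, ((f (x + a)).val : ℤ) = ∑ x, ((f x).val : ℤ) :=
    Equiv.sum_comp (Equiv.addRight a) (fun x => ((f x).val : ℤ))
  obtain ⟨p, hp⟩ : ∃ p : ℤ, ∑ x, ((f x).val : ℤ) = 2 * p + 1 := by
    have h : ((∑ x, ((f x).val : ℤ) : ℤ) : ZMod 2) = (1 : ℤ) := by
      push_cast
      simpa using hf
    obtain ⟨c, hc⟩ := (ZMod.intCast_eq_intCast_iff_dvd_sub _ _ _).1 h.symm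
    exact ⟨c, by push_cast at hc; linarith⟩
  obtain ⟨q, hq⟩ : ∃ q : ℤ, ∑ x, ((f x).val : ℤ) * ((f (x + a)).val : ℤ) = 2 * q := by
    have h : ((∑ x, ((f x).val : ℤ) * ((f (x + a)).val : ℤ) : ℤ) : ZMod 2) = 0 := by
      push_cast
      simpa using sum_mul_translate f ha
    obtain ⟨c, hc⟩ := (ZMod.intCast_zmod_eq_zero_iff_dvd _ 2).1 h
    exact ⟨c, by push_cast at hc; linarith⟩
  have hx : ∀ x, signZMod (f x) * signZMod (f (x + a)) = 1 - 2 * ((f x).val : ℤ)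
      - 2 * ((f (x + a)).val : ℤ) + 4 * (((f x).val : ℤ) * ((f (x + a)).val : ℤ)) := by
    intro x
    rw [hs, hs]
    ring
  obtain ⟨n, rfl⟩ := Nat.exists_eq_add_of_le hm
  refine ⟨2 ^ n - p + q - 1, ?_⟩
  simp only [hx, Finset.sum_add_distrib, Finset.sum_sub_distrib, ← Finset.mul_sum, ht, hp, hq]
  simp [ZMod.card, pow_add]
  ring

theorem sum_coordFun (hm : 2 ≤ m) (i : Fin m) : ∑ x, coordFun i x = 0 := by
  obtain ⟨j, hj⟩ : ∃ j : Fin m, j ≠ i := by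
    have : Nontrivial (Fin m) := Fin.nontrivial_iff_two_le.2 hm
    exact exists_ne i
  have haa : ∀ x : Fin m → ZMod 2, x + Pi.single j 1 + Pi.single j 1 = x := fun x => by
    funext i
    simp [add_assoc, CharTwo.add_self_eq_zero]
  refine Finset.sum_involution (fun x _ => x + Pi.single j 1) ?_ ?_ ?_ ?_
  · intro x _
    simp [coordFun, hj.symm, CharTwo.add_self_eq_zero]
  · intro x _ _ h
    simp at h
  · simp
  · intro x _
    exact haa x

theorem sum_affineFun_zero (hm : 2 ≤ m) (u : Fin m → ZMod 2) : ∑ x, affineFun 0 u x = 0 := by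
  simp only [affineFun, zero_add]
  rw [Finset.sum_comm]
  refine Finset.sum_eq_zero fun i _ => ?_
  rw [← Finset.mul_sum]
  have h := sum_coordFun hm i
  simp only [coordFun] at h
  rw [h, mul_zero]

/-- The covering radius of `RM(1, 5)` is at most `12`. -/
theorem exists_hammingDist_le_twelve (f : BoolFun 5) :
    ∃ g ∈ reedMuller 1 5, hammingDist f g ≤ 12 := by
  by_contra! hc
  have hd : ∀ u, 13 ≤ hammingDist f (affineFun 0 u) ∧ hammingDist f (affineFun 0 u) ≤ 19 := by
    intro u
    have h0 := hc _ (mem_reedMuller_one_iff.2 ⟨0, u, rfl⟩)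
    have h1 := hc _ (mem_reedMuller_one_iff.2 ⟨1, u, rfl⟩)
    have h2 := hammingDist_affineFun_one f u
    omega
  -- Affine functions have even weight, so all these distances have the parity of the weight of f.
  have hpar : ∀ u, (hammingDist f (affineFun 0 u) : ZMod 2) = ∑ x, f x := by
    intro u
    rw [cast_hammingDist, sum_affineFun_zero (by norm_num), add_zero]
  set W := walsh (fun x => signZMod (f x)) with hW
  have hWd : ∀ u, W u = 32 - 2 * hammingDist f (affineFun 0 u) := fun u => by
    rw [hW, walsh_signZMod]; norm_num
  have hsq : ∀ c, signZMod c ^ 2 = 1 := by decide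
  have hpars : ∑ u, W u ^ 2 = 1024 := by
    rw [hW, sum_walsh_sq]
    simp [hsq, ZMod.card]
  rcases zmod_two_eq_zero_or_one (∑ x, f x) with hs | hs
  -- Even weight: the distances lie in {14, 16, 18}, so |W| ≤ 4 and the sum of squares is at most
  -- 512, against 1024 from Parseval.
  · have hle : ∀ u, W u ^ 2 ≤ 16 := by
      intro u
      have h := hpar u
      rw [hs, ZMod.natCast_eq_zero_iff] at h
      obtain ⟨k, hk⟩ := h
      have := hd u
      have h1 := hWd u
      rw [hk] at h1 this
      have : 7 ≤ k ∧ k ≤ 9 := by omega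
      push_cast at h1
      have : -4 ≤ W u ∧ W u ≤ 4 := by omega
      nlinarith
    have h := Finset.sum_le_sum fun u (_ : u ∈ Finset.univ) => hle u
    rw [hpars] at h
    simp [ZMod.card] at h
  -- Odd weight: W takes only the values ±2 and ±6, and b is the indicator of W = ±2.
  · obtain ⟨b, hb⟩ : ∃ b : (Fin 5 → ZMod 2) → ℤ, ∀ u, W u ^ 2 = 36 - 32 * b u ∧ b u ^ 2 = b u := by
      refine ⟨fun u => if W u = 2 ∨ W u = -2 then 1 else 0, fun u => ?_⟩
      have h := hpar u
      rw [hs] at h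
      replace h := (ZMod.natCast_eq_natCast_iff' _ 1 2).1 (h.trans Nat.cast_one.symm)
      have h1 := hd u
      have h2 := hWd u
      have : W u = 6 ∨ W u = 2 ∨ W u = -2 ∨ W u = -6 := by omega
      rcases this with h | h | h | h <;> simp [h]
    -- Transforming W² = 36 - 32b relates the transform of b to the autocorrelation of the signs of
    -- f. At a = 0 it shows that b has support of size 4; at a ≠ 0 it gives `walsh b a` ≡ 4 modulo
    -- 8.
    have hcorr : ∀ a, 36 * (∑ u : Fin 5 → ZMod 2, signZMod (u ⬝ᵥ a)) - 32 * walsh b a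
        = 32 * ∑ x, signZMod (f x) * signZMod (f (x + a)) := by
      intro a
      have h := sum_walsh_mul_walsh (fun x => signZMod (f x)) (fun x => signZMod (f x)) a
      rw [← hW] at h
      norm_num at h
      rw [← h, walsh, Finset.mul_sum, Finset.mul_sum, ← Finset.sum_sub_distrib]
      refine Finset.sum_congr rfl fun u _ => ?_
      rw [← sq, (hb u).1, dotProduct_comm a u]
      ring
    have hb0 : walsh b 0 = 4 := by
      have h := hcorr 0
      rw [sum_signZMod_dotProduct] at h
      simp [← sq, hsq, ZMod.card] at h
      linarith
    have hba : ∀ a, 16 ≤ walsh b a ^ 2 := by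
      intro a
      by_cases ha : a = 0
      · rw [ha, hb0]; norm_num
      · have h := hcorr a
        obtain ⟨k, hk⟩ := autocorrelation_mod_eight (by norm_num) hs ha
        rw [sum_signZMod_dotProduct, if_neg ha, hk] at h
        have h1 : walsh b a = -(8 * k + 4) := by linarith
        rw [h1]
        -- This suffices because (8k + 4)² = 64k(k + 1) + 16.
        have : 0 ≤ k * (k + 1) := by
          rcases le_or_gt 0 k with h | h <;> nlinarith
        nlinarith
    -- Summing over the 32 points gives at least 512, while Parseval for b gives 32 · 4 = 128.
    have h := Finset.sum_le_sum fun u (_ : u ∈ Finset.univ) => hba u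
    have h0 : walsh b 0 = ∑ u, b u ^ 2 := by
      simp only [(hb _).2]
      simp [walsh, signZMod]
    rw [sum_walsh_sq, ← h0, hb0] at h
    simp [ZMod.card] at h

end Walsh

/-! Metric regularity of `RM(1, 5)`. -/

section Regular

variable {ι : Type*} [Fintype ι]

theorem distToSet_le {X : Set (ι → ZMod 2)} {x y : ι → ZMod 2} (hx : x ∈ X) :
    distToSet y X ≤ hammingDist y x :=
  Nat.sInf_le ⟨x, hx, rfl⟩

/-- Nonemptiness matters: the infimum of the empty set of naturals is 0. -/
theorem le_distToSet_iff {X : Set (ι → ZMod 2)} (hX : X.Nonempty) {y : ι → ZMod 2} {t : ℕ} :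
    t ≤ distToSet y X ↔ ∀ x ∈ X, t ≤ hammingDist y x := by
  refine ⟨fun h x hx => h.trans (distToSet_le hx), fun h => ?_⟩
  refine le_csInf (hX.image _) ?_
  rintro _ ⟨x, hx, rfl⟩
  exact h x hx

theorem coveringRadius_eq [DecidableEq ι] {X : Set (ι → ZMod 2)} {t : ℕ} (h : ∀ y, distToSet y X ≤ t)
    {z : ι → ZMod 2} (hz : t ≤ distToSet z X) : coveringRadius X = t :=
  le_antisymm (Finset.sup_le fun y _ => h y)
    (hz.trans (Finset.le_sup (f := fun z => distToSet z X) (Finset.mem_univ z)))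

/-- The upper bound and the witness z force the covering radius to be t; attaining it then only
requires the lower bound. -/
theorem metricComplement_eq [DecidableEq ι] {X : Set (ι → ZMod 2)} (hX : X.Nonempty) {t : ℕ}
    (h : ∀ y, ∃ x ∈ X, hammingDist y x ≤ t) {z : ι → ZMod 2}
    (hz : ∀ x ∈ X, t ≤ hammingDist z x) :
    metricComplement X = {y | ∀ x ∈ X, t ≤ hammingDist y x} := by
  have hle : ∀ y, distToSet y X ≤ t := fun y =>
    let ⟨_, hx, hxy⟩ := h y
    (distToSet_le hx).trans hxy
  ext y
  rw [metricComplement, Set.mem_ofPred_eq, Set.mem_ofPred_eq, ← le_distToSet_iff hX,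
    coveringRadius_eq hle ((le_distToSet_iff hX).2 hz)]
  exact ⟨fun h => h.ge, fun h => le_antisymm (hle y) h⟩

/-- The quadratic form `x₀ x₁ + x₂ x₃` in five variables. -/
def quadForm : BoolFun 5 := coordFun 0 * coordFun 1 + coordFun 2 * coordFun 3

/-- The form is bent in its four variables, at distance 6 from affine functions there; the free
fifth variable doubles this to 12. The proof checks all 64 affine functions. -/
theorem quadForm_mem_farFromAffine : quadForm ∈ farFromAffine 5 12 := by
  intro g hg
  obtain ⟨c, u, rfl⟩ := mem_reedMuller_one_iff.1 hg
  clear hg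
  revert c u
  decide +kernel

theorem zero_mem_reedMuller_one (m : ℕ) : (0 : BoolFun m) ∈ reedMuller 1 m :=
  const_mem_reedMuller_one 0

theorem farStabilizer_subset_reedMuller_one : farStabilizer 5 12 ⊆ reedMuller 1 5 := by
  intro f hf
  by_contra hf1
  have hV := closedUnderDeriv_farStabilizer 5 12
  have hq : quadForm ∈ farStabilizer 5 12 := add_mem_farStabilizer
    (hV.coordFun_mul_coordFun_mem (by norm_num) hf hf1 (by decide))
    (hV.coordFun_mul_coordFun_mem (by norm_num) hf hf1 (by decide))
  -- The form plus itself is 0, which would have to be at distance at least 12 from the affine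
  -- function 0.
  have h := hq _ quadForm_mem_farFromAffine 0 (zero_mem_reedMuller_one 5)
  rw [hammingDist_add_left_eq, add_zero, hammingDist_self] at h
  omega

end Regular

theorem theorem1 : MetricallyRegular (reedMuller 1 5) := by
  have h1 : metricComplement (reedMuller 1 5) = farFromAffine 5 12 :=
    metricComplement_eq ⟨0, zero_mem_reedMuller_one 5⟩ exists_hammingDist_le_twelve
      quadForm_mem_farFromAffine
  have hfar : ∀ f ∈ reedMuller 1 5, ∀ g ∈ farFromAffine 5 12, 12 ≤ hammingDist f g :=
    fun f hf g hg => hammingDist_comm g f ▸ hg f hf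
  have h2 : metricComplement (farFromAffine 5 12)
      = {f | ∀ g ∈ farFromAffine 5 12, 12 ≤ hammingDist f g} := by
    refine metricComplement_eq ⟨_, quadForm_mem_farFromAffine⟩ (fun f => ?_)
      (hfar 0 (zero_mem_reedMuller_one 5))
    -- If an affine g is within 12 of f + `quadForm`, then the far function `quadForm` + g is within
    -- 12 of f.
    obtain ⟨g, hg, hfg⟩ := exists_hammingDist_le_twelve (f + quadForm)
    refine ⟨_, add_mem_farFromAffine quadForm_mem_farFromAffine hg, ?_⟩
    rwa [← hammingDist_add_left_eq]
  rw [MetricallyRegular, h1, h2]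
  refine Set.Subset.antisymm (fun f hf => farStabilizer_subset_reedMuller_one ?_) hfar
  -- The distance from f + g to an affine h is that from f to g + h, and g + h is again far.
  intro g hg h hh
  rw [hammingDist_add_left_eq]
  exact hf _ (add_mem_farFromAffine hg hh)
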